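/- Let $a,b,c$ be real numbers with $0<a<b<c$. Let $$\mathcal G(\chi_{[0,c)},a\mathbb Z\times\mathbb Z/b)=\{\,e^{-2\pi i n t/b}\,\chi_{[0,c)}(t-ma):\ (m,n)\in\mathbb Z\times\mathbb Z\,\}\subset L^2(\mathbb R)$$ be the Gabor system generated by the characteristic function of $[0,c)$; it is a Gabor frame if there are constants $0<A\le B<\infty$ with $A\|f\|_2^2\le\sum_{\phi\in\mathcal G}|\langle f,\phi\rangle|^2\le B\|f\|_2^2$ for all $f\in L^2(\mathbb R)$. For $t\in\mathbb R$ let $$\mathbf M_{a,b,c}(t)=\big(\chi_{[0,c)}(t-\mu+\lambda)\big)_{\mu\in a\mathbb Z,\ \lambda\in b\mathbb Z},$$ an infinite matrix whose rows have finitely many nonzero entries, acting on arbitrary real vectors indexed by $b\mathbb Z$, and let $N(\mathbf M_{a,b,c}(t))$ be its null space. Let $\mathcal B_b$ be the set of all vectors $(\mathbf x(\lambda))_{\lambda\in b\mathbb Z}$ with entries in $\{0,1\}$, let $\mathcal B_b^0=\{\mathbf x\in\mathcal B_b:\mathbf x(0)=1\}$, let $\mathcal B_b-\mathcal B_b=\{\mathbf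 x-\mathbf y:\mathbf x,\mathbf y\in\mathcal B_b\}$ (the vectors with entries in $\{-1,0,1\}$), and let $\mathcal D_{a,b,c}$ be the set of all $t\in\mathbb R$ for which there is $\mathbf x\in\mathcal B_b^0$ such that every entry of $\mathbf M_{a,b,c}(t)\mathbf x$ equals $2$. Then the following statements are equivalent: (i) $\mathcal G(\chi_{[0,c)},a\mathbb Z\times\mathbb Z/b)$ is a Gabor frame for $L^2(\mathbb R)$; (ii) $N(\mathbf M_{a,b,c}(t))\cap(\mathcal B_b-\mathcal B_b)=\{\mathbf 0\}$ for every $t\in\mathbb R$; (iii) $\mathcal D_{a,b,c}=\emptyset$. -/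

import Mathlib

open scoped Pointwise ENNReal

noncomputable section

/-- A family `φ` in a complex Hilbert space `H` is a frame if there are constants
`0 < A` and `B < ∞` with `A ‖f‖² ≤ ∑ᵢ |⟨f, φᵢ⟩|² ≤ B ‖f‖²` for all `f`
(the sum is taken in `[0, ∞]`). -/
def IsFrame {ι H : Type*} [NormedAddCommGroup H] [InnerProductSpace ℂ H] (φ : ι → H) : Prop :=
  ∃ A B : NNReal, 0 < A ∧ ∀ f : H,
    (A : ℝ≥0∞) * ‖f‖ₑ ^ 2 ≤ ∑' i, ‖inner ℂ (φ i) f‖ₑ ^ 2 ∧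
      ∑' i, ‖inner ℂ (φ i) f‖ₑ ^ 2 ≤ (B : ℝ≥0∞) * ‖f‖ₑ ^ 2

/-- The time-frequency shift `t ↦ e^{-2πi n t / b} g (t - m a)` of the window `g`. -/
def gaborFun (g : ℝ → ℂ) (a b : ℝ) (p : ℤ × ℤ) (t : ℝ) : ℂ :=
  Complex.exp (-2 * Real.pi * Complex.I * p.2 * t / b) * g (t - p.1 * a)

theorem norm_gaborFun (g : ℝ → ℂ) (a b : ℝ) (p : ℤ × ℤ) (t : ℝ) :
    ‖gaborFun g a b p t‖ = ‖g (t - p.1 * a)‖ := by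
  have h : (-2 * Real.pi * Complex.I * p.2 * t / b : ℂ)
      = ((-2 * Real.pi * p.2 * t / b : ℝ) : ℂ) * Complex.I := by
    push_cast
    ring
  rw [gaborFun, norm_mul, h, Complex.norm_exp_ofReal_mul_I, one_mul]

theorem memLp_gaborFun {g : ℝ → ℂ} (hg : MeasureTheory.MemLp g 2 MeasureTheory.volume)
    (a b : ℝ) (p : ℤ × ℤ) :
    MeasureTheory.MemLp (gaborFun g a b p) 2 MeasureTheory.volume := by
  have h := hg.comp_measurePreserving
    (MeasureTheory.measurePreserving_sub_right MeasureTheory.volume ((p.1 : ℝ) * a))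
  refine h.of_le ?_ (Filter.Eventually.of_forall fun t => (norm_gaborFun g a b p t).le)
  exact (Continuous.aestronglyMeasurable (by fun_prop)).mul h.aestronglyMeasurable

/-- The Gabor system `G(g, aℤ × ℤ/b)` as a family in `L²(ℝ)` indexed by `(m, n) ∈ ℤ × ℤ`. -/
def gaborSystem (g : ℝ → ℂ) (hg : MeasureTheory.MemLp g 2 MeasureTheory.volume) (a b : ℝ)
    (p : ℤ × ℤ) : MeasureTheory.Lp ℂ 2 (MeasureTheory.volume : MeasureTheory.Measure ℝ) :=
  (memLp_gaborFun hg a b p).toLp (gaborFun g a b p)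

/-- The ideal window `χ_{[0,c)}`. -/
def idealWindow (c : ℝ) : ℝ → ℂ := Set.indicator (Set.Ico 0 c) 1

theorem memLp_idealWindow (c : ℝ) :
    MeasureTheory.MemLp (idealWindow c) 2 MeasureTheory.volume :=
  MeasureTheory.memLp_indicator_const 2 measurableSet_Ico (1 : ℂ) (Or.inr (by simp))

/-- The infinite matrix `M_{a,b,c}(t) = (χ_{[0,c)}(t - μ + λ))`, `μ ∈ aℤ`, `λ ∈ bℤ`.
For `a, b > 0` the row `μ = m a` is labelled by `m ∈ ℤ`, the column `λ = n b` by `n ∈ ℤ`. -/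
def gaborMatrix (a b c t : ℝ) : Matrix ℤ ℤ ℝ :=
  fun m n => Set.indicator (Set.Ico 0 c) 1 (t - m * a + n * b)

/-- The product `M_{a,b,c}(t) z` with an arbitrary vector `z = (z(n b))`. Each row of the
matrix has finite support when `b > 0` (see `gaborMatrix_row_finite`), so that the sum is a
finite one. -/
def gaborMatrixMul (a b c t : ℝ) (z : ℤ → ℝ) : ℤ → ℝ :=
  fun m => ∑ᶠ n : ℤ, gaborMatrix a b c t m n * z n

theorem gaborMatrix_row_finite {a b c t : ℝ} (hb : 0 < b) (m : ℤ) (z : ℤ → ℝ) :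
    (Function.support fun n : ℤ => gaborMatrix a b c t m n * z n).Finite := by
  refine (Set.finite_Icc ⌊(m * a - t) / b⌋ ⌈(m * a - t + c) / b⌉).subset fun n hn => ?_
  have h : t - m * a + n * b ∈ Set.Ico 0 c := by
    by_contra h
    exact hn (by simp [gaborMatrix, h])
  constructor
  · have h1 : (m * a - t) / b ≤ n := by
      rw [div_le_iff₀ hb]
      linarith [h.1]
    exact_mod_cast (Int.floor_le _).trans h1
  · have h2 : (n : ℝ) ≤ (m * a - t + c) / b := by
      rw [le_div_iff₀ hb]
      linarith [h.2]
    exact_mod_cast h2.trans (Int.le_ceil _)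

/-- The null space of `M_{a,b,c}(t)` in the space of all vectors. -/
def gaborNullSpace (a b c t : ℝ) : Set (ℤ → ℝ) := {z | gaborMatrixMul a b c t z = 0}

/-- Binary vectors; the coordinate at `n b` is `x n`. -/
def binaryVectors : Set (ℤ → ℝ) := {x | ∀ n, x n = 0 ∨ x n = 1}

/-- Binary vectors taking the value one at the origin. -/
def binaryVectorsZero : Set (ℤ → ℝ) := {x | x ∈ binaryVectors ∧ x 0 = 1}

/-- The set `D_{a,b,c}` of all `t` such that `M_{a,b,c}(t) x = 2` (all entries equal to two)
for some binary vector `x` with `x(0) = 1`. -/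
def gaborD (a b c : ℝ) : Set ℝ :=
  {t | ∃ x ∈ binaryVectorsZero, gaborMatrixMul a b c t x = fun _ => 2}

end

/-! Each row of the matrix is the indicator of an integer interval, its window. As `a < b`, passing
to the next row moves either end of the window by at most one column; as `b < c`, no window is
empty. If a vector is written as the differences of a potential `F`, its window sum is the increment
of `F` between the two ends.

This links null vectors to binary vectors. If all rows annihilate `z`, an entry entering the window
must cancel the entry leaving it, so every window contains the same number `K` of support points,
and `K ≥ 2` if `z ≠ 0`, because a single nonzero entry cannot sum to zero. Keeping two out of every
`K` support points gives a binary vector with all window sums two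
(`exists_binary_of_windowSum_eq_zero`). Conversely, alternating signs on the support of such a
binary vector give a null vector with entries in `{-1, 0, 1}` (`exists_alternating`). Hence (ii) and
(iii) are equivalent.

Periodization over `bℤ` and Parseval's identity turn the frame sum of `f` into `b` times the
integral, over one period, of the squared `ℓ²` norm of the matrix at `t` applied to the fibre `(f (t
+ k b))_k`. So the frame property is a matter of `ℓ²` bounds uniform in `t`. The upper bound holds
because rows and columns contain boundedly many ones. If `D` is empty, compactness shows that
finitely many rows already control `z 0`, with one constant for all `t ∈ [0, a]`; translating and
summing gives the lower bound (`exists_tsum_enorm_sq_le`). If `D` is not empty, truncations of the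
alternating null vector have unbounded norm but images of bounded norm, and functions concentrated
near `t + bℤ` carry this over to `L²` (`le_of_frame_bound`). -/

noncomputable section

/-! ### Windows -/

/-- The first column `n` with `t - m a + n b ≥ 0`. -/
def leftEnd (a b t : ℝ) (m : ℤ) : ℤ := ⌈(m * a - t) / b⌉

/-- The set of columns in which row `m` of the matrix `M_{a,b,c}(t)` has the entry one. -/
def window (a b c t : ℝ) (m : ℤ) : Finset ℤ :=
  Finset.Ico (leftEnd a b t m) (leftEnd a b (t - c) m)

/-- The product of row `m` of `M_{a,b,c}(t)` with a vector with entries in an additive group. -/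
def windowSum {E : Type*} [AddCommMonoid E] (a b c t : ℝ) (z : ℤ → E) (m : ℤ) : E :=
  ∑ n ∈ window a b c t m, z n

theorem leftEnd_le_iff {a b t : ℝ} (hb : 0 < b) {m n : ℤ} :
    leftEnd a b t m ≤ n ↔ 0 ≤ t - m * a + n * b := by
  rw [leftEnd, Int.ceil_le, div_le_iff₀ hb]
  constructor <;> intro h <;> linarith

theorem lt_leftEnd_iff {a b t : ℝ} (hb : 0 < b) {m n : ℤ} :
    n < leftEnd a b t m ↔ t - m * a + n * b < 0 := by
  rw [← not_le, leftEnd_le_iff hb, not_le]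

theorem mem_window {a b c t : ℝ} (hb : 0 < b) {m n : ℤ} :
    n ∈ window a b c t m ↔ t - m * a + n * b ∈ Set.Ico 0 c := by
  rw [window, Finset.mem_Ico, leftEnd_le_iff hb, lt_leftEnd_iff hb, Set.mem_Ico]
  refine and_congr_right fun _ => ?_
  constructor <;> intro h <;> linarith

theorem gaborMatrixMul_eq_windowSum {a b c t : ℝ} (hb : 0 < b) (z : ℤ → ℝ) :
    gaborMatrixMul a b c t z = windowSum a b c t z := by
  funext m
  rw [gaborMatrixMul, windowSum, finsum_eq_sum_of_support_subset (s := window a b c t m)]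
  · refine Finset.sum_congr rfl fun n hn => ?_
    simp [gaborMatrix, (mem_window hb).1 hn]
  · intro n hn
    by_contra h
    rw [Finset.mem_coe, mem_window hb] at h
    exact hn (by simp [gaborMatrix, h])

/-- One row moves the threshold `(m * a - t) / b` by `a / b`, which lies strictly between zero and
one. -/
theorem leftEnd_succ {a b t : ℝ} (ha : 0 < a) (hab : a < b) (m : ℤ) :
    leftEnd a b t (m + 1) = leftEnd a b t m ∨ leftEnd a b t (m + 1) = leftEnd a b t m + 1 := by
  have hb := ha.trans hab
  have h1 : leftEnd a b t m ≤ leftEnd a b t (m + 1) := by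
    have := (leftEnd_le_iff (a := a) (t := t) hb).1 (le_refl (leftEnd a b t (m + 1)))
    rw [leftEnd_le_iff hb]
    push_cast at this
    linarith
  have h2 : leftEnd a b t (m + 1) ≤ leftEnd a b t m + 1 := by
    have := (leftEnd_le_iff (a := a) (t := t) hb).1 (le_refl (leftEnd a b t m))
    rw [leftEnd_le_iff hb]
    push_cast
    linarith
  omega

theorem leftEnd_lt_leftEnd {a b c t : ℝ} (hb : 0 < b) (hbc : b < c) (m : ℤ) :
    leftEnd a b t m < leftEnd a b (t - c) m := by
  have h : t - m * a + ((leftEnd a b t m - 1 : ℤ) : ℝ) * b < 0 :=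
    (lt_leftEnd_iff hb).1 (by omega)
  rw [lt_leftEnd_iff hb]
  push_cast at h
  linarith

/-- Translation of rows and columns. -/
theorem windowSum_shift {E : Type*} [AddCommMonoid E] (a b c t : ℝ) (hb : 0 < b) (z : ℤ → E)
    (m k j : ℤ) :
    windowSum a b c (t + k * b - j * a) (fun n => z (n + k)) m = windowSum a b c t z (m + j) := by
  refine Finset.sum_bij (fun n _ => n + k) (fun n hn => ?_) (fun _ _ _ _ h => by omega)
    (fun n hn => ⟨n - k, ?_, by omega⟩) (fun _ _ => rfl)
  · rw [mem_window hb] at hn ⊢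
    convert hn using 1
    push_cast
    ring
  · rw [mem_window hb] at hn ⊢
    convert hn using 1
    push_cast
    ring

/-! ### Sums over integer intervals -/

theorem sum_Ico_sub_int {E : Type*} [AddCommGroup E] (F : ℤ → E) {l r : ℤ} (h : l ≤ r) :
    ∑ n ∈ Finset.Ico l r, (F (n + 1) - F n) = F r - F l := by
  induction r, h using Int.leInduction with
  | base => simp
  | succ r hr ih =>
    have : Finset.Ico l (r + 1) = insert r (Finset.Ico l r) := by
      ext n
      simp only [Finset.mem_Ico, Finset.mem_insert]
      omega
    rw [this, Finset.sum_insert (by simp), ih]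
    abel

/-- A discrete antiderivative. Reducing it modulo two or applying a floor division to it yields new
vectors whose window sums are known from the values at the window ends. -/
theorem exists_potential {E : Type*} [AddCommGroup E] (x : ℤ → E) :
    ∃ F : ℤ → E, ∀ n, F (n + 1) - F n = x n := by
  refine ⟨fun n => ∑ i ∈ Finset.Ico 0 n, x i - ∑ i ∈ Finset.Ico n 0, x i, fun n => ?_⟩
  rcases le_or_gt 0 n with hn | hn
  · have h1 : Finset.Ico 0 (n + 1) = insert n (Finset.Ico 0 n) := by
      ext k
      simp only [Finset.mem_Ico, Finset.mem_insert]
      omega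
    have h2 : Finset.Ico (n + 1) 0 = ∅ := Finset.Ico_eq_empty (by omega)
    have h3 : Finset.Ico n 0 = ∅ := Finset.Ico_eq_empty (by omega)
    simp only [h1, h2, h3, Finset.sum_insert Finset.right_notMem_Ico]
    simp
  · have h1 : Finset.Ico n 0 = insert n (Finset.Ico (n + 1) 0) := by
      ext k
      simp only [Finset.mem_Ico, Finset.mem_insert]
      omega
    have h2 : Finset.Ico 0 (n + 1) = ∅ := Finset.Ico_eq_empty (by omega)
    have h3 : Finset.Ico 0 n = ∅ := Finset.Ico_eq_empty (by omega)
    simp only [h1, h2, h3]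
    rw [Finset.sum_insert (by simp)]
    simp

theorem windowSum_sub {E : Type*} [AddCommGroup E] {a b c t : ℝ} (hb : 0 < b) (hbc : b < c)
    (F : ℤ → E) (m : ℤ) :
    windowSum a b c t (fun n => F (n + 1) - F n) m =
      F (leftEnd a b (t - c) m) - F (leftEnd a b t m) :=
  sum_Ico_sub_int F (leftEnd_lt_leftEnd hb hbc m).le

/-- The change of a window sum from one row to the next. -/
theorem windowSum_succ {E : Type*} [AddCommGroup E] {a b c t : ℝ} (ha : 0 < a) (hab : a < b)
    (hbc : b < c) (z : ℤ → E) (m : ℤ) :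
    windowSum a b c t z (m + 1) - windowSum a b c t z m =
      (if leftEnd a b (t - c) (m + 1) = leftEnd a b (t - c) m then 0
        else z (leftEnd a b (t - c) m)) -
      (if leftEnd a b t (m + 1) = leftEnd a b t m then 0 else z (leftEnd a b t m)) := by
  obtain ⟨F, hF⟩ := exists_potential z
  obtain rfl : (fun n => F (n + 1) - F n) = z := funext hF
  rw [windowSum_sub (ha.trans hab) hbc, windowSum_sub (ha.trans hab) hbc]
  have h1 := leftEnd_succ (t := t) ha hab m
  have h2 := leftEnd_succ (t := t - c) ha hab m
  rcases h1 with h1 | h1 <;> rcases h2 with h2 | h2 <;>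
    simp only [h1, h2, add_eq_left, one_ne_zero, if_true, if_false] <;>
    abel

/-! ### Null vectors and binary vectors -/

/-- Splitting a binary vector with window sums two into alternating signs. -/
theorem exists_alternating {a b c t : ℝ} (hb : 0 < b) (hbc : b < c) {x : ℤ → ℤ}
    (hx : ∀ n, x n = 0 ∨ x n = 1) (h2 : ∀ m, windowSum a b c t x m = 2) :
    ∃ g : ℤ → ℤ, (∀ n, g n = 0 ∨ g n = 1) ∧ (∀ n, g (n + 1) - g n = 0 ↔ x n = 0) ∧
      ∀ m, windowSum a b c t (fun n => g (n + 1) - g n) m = 0 := by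
  obtain ⟨F, hF⟩ := exists_potential x
  obtain rfl : (fun n => F (n + 1) - F n) = x := funext hF
  -- `F` counts the support of `x`, so its parity flips exactly there; each window raises `F` by two
  -- and preserves the parity.
  refine ⟨fun n => F n % 2, fun n => Int.emod_two_eq_zero_or_one (F n), fun n => ?_, fun m => ?_⟩
  · have : F (n + 1) - F n = 0 ∨ F (n + 1) - F n = 1 := hx n
    show F (n + 1) % 2 - F n % 2 = 0 ↔ F (n + 1) - F n = 0
    omega
  · have := h2 m
    rw [windowSum_sub hb hbc] at this
    rw [windowSum_sub hb hbc (fun n => F n % 2)]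
    omega

/-- The support of a vector annihilated by consecutive rows has equally many points in each of
the corresponding windows. -/
theorem windowSum_support_eq {E : Type*} [AddCommGroup E] {a b c t : ℝ} (ha : 0 < a)
    (hab : a < b) (hbc : b < c) {z : ℤ → E} {s : ℤ → ℤ} (hs0 : ∀ n, z n = 0 → s n = 0)
    (hs1 : ∀ n, z n ≠ 0 → s n = 1) {I : Set ℤ} (hI : I.OrdConnected)
    (hz : ∀ m ∈ I, windowSum a b c t z m = 0) {m m' : ℤ} (hm : m ∈ I) (hm' : m' ∈ I) :
    windowSum a b c t s m = windowSum a b c t s m' := by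
  have step : ∀ k, k ∈ I → k + 1 ∈ I → windowSum a b c t s (k + 1) = windowSum a b c t s k := by
    intro k h1 h2
    have e1 := windowSum_succ (t := t) ha hab hbc z k
    have e2 := windowSum_succ (t := t) ha hab hbc s k
    rw [hz _ h1, hz _ h2, sub_self] at e1
    rw [← sub_eq_zero, e2]
    have key : ∀ n n', z n = z n' → s n = s n' := by
      intro n n' h
      by_cases h0 : z n = 0
      · rw [hs0 _ h0, hs0 _ (h ▸ h0)]
      · rw [hs1 _ h0, hs1 _ (h ▸ h0)]
    -- Neither end moves; only the left one; only the right one; both. A lone entry leaving or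
    -- entering is zero, and in the last case the two entries are equal.
    split_ifs at e1 ⊢
    · simp
    · rw [hs0 _ (by simpa using e1.symm), sub_zero]
    · rw [hs0 _ (by simpa using e1.symm), sub_zero]
    · rw [key _ _ (sub_eq_zero.1 e1.symm), sub_self]
  have main : ∀ k, k ∈ I → ∀ l, k ≤ l → l ∈ I →
      windowSum a b c t s l = windowSum a b c t s k := by
    intro k hk l hkl
    induction l, hkl using Int.leInduction with
    | base => exact fun _ => rfl
    | succ l hl ih =>
      intro hl'
      have : l ∈ I := hI.out hk hl' ⟨hl, by omega⟩
      rw [step l this hl', ih this]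
  rcases le_total m m' with h | h
  · exact (main m hm m' h hm').symm
  · exact main m' hm' m h hm

/-- A vector annihilated by consecutive rows and not vanishing on one of the corresponding windows
yields a binary vector whose sums over these windows are two. -/
theorem exists_binary_of_windowSum_eq_zero {E : Type*} [AddCommGroup E] {a b c t : ℝ}
    (ha : 0 < a) (hab : a < b) (hbc : b < c) {z : ℤ → E} {I : Set ℤ} (hI : I.OrdConnected)
    (hz : ∀ m ∈ I, windowSum a b c t z m = 0) {m₀ n₀ : ℤ} (hm₀ : m₀ ∈ I)
    (hn₀ : n₀ ∈ window a b c t m₀) (h0 : z n₀ ≠ 0) :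
    ∃ x : ℤ → ℤ, (∀ n, x n = 0 ∨ x n = 1) ∧ ∀ m ∈ I, windowSum a b c t x m = 2 := by
  classical
  have hb := ha.trans hab
  set s : ℤ → ℤ := fun n => if z n = 0 then 0 else 1 with hs
  have hs0 : ∀ n, z n = 0 → s n = 0 := fun n h => by simp [hs, h]
  have hs1 : ∀ n, z n ≠ 0 → s n = 1 := fun n h => by simp [hs, h]
  have hs01 : ∀ n, s n = 0 ∨ s n = 1 := fun n => by
    by_cases h : z n = 0
    · exact Or.inl (hs0 n h)
    · exact Or.inr (hs1 n h)
  set K := windowSum a b c t s m₀ with hK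
  have hconst : ∀ m ∈ I, windowSum a b c t s m = K := fun m hm =>
    windowSum_support_eq ha hab hbc hs0 hs1 hI hz hm hm₀
  have hK2 : 2 ≤ K := by
    obtain ⟨n₁, hn₁, hne, h1⟩ : ∃ n₁ ∈ window a b c t m₀, n₁ ≠ n₀ ∧ z n₁ ≠ 0 := by
      by_contra! h
      exact h0 (by rw [← hz m₀ hm₀, windowSum, Finset.sum_eq_single_of_mem n₀ hn₀ h])
    have hle : ∑ n ∈ {n₁, n₀}, s n ≤ K := by
      refine Finset.sum_le_sum_of_subset_of_nonneg ?_ fun n _ _ => ?_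
      · intro n hn
        rcases Finset.mem_insert.1 hn with rfl | hn
        · exact hn₁
        · rwa [Finset.mem_singleton.1 hn]
      · rcases hs01 n with h | h <;> simp [h]
    rw [Finset.sum_pair hne, hs1 _ h1, hs1 _ h0] at hle
    exact hle
  obtain ⟨F, hF⟩ := exists_potential s
  have hKpos : 0 < K := by omega
  -- Each window raises `F` by `K`, hence `2 * F / K` by exactly two, and `2 ≤ K` keeps each single
  -- increment at most one.
  refine ⟨fun n => 2 * F (n + 1) / K - 2 * F n / K, fun n => ?_, fun m hm => ?_⟩
  · have h1 : F (n + 1) = F n + s n := by rw [← hF n]; ring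
    rcases hs01 n with h | h
    · left
      simp [h1, h]
    · have h3 : 2 * F n / K ≤ 2 * F (n + 1) / K := Int.ediv_le_ediv hKpos (by omega)
      have h4 : 2 * F (n + 1) / K ≤ (2 * F n + K) / K := Int.ediv_le_ediv hKpos (by omega)
      rw [Int.add_ediv_of_dvd_right (dvd_refl K), Int.ediv_self hKpos.ne'] at h4
      simp only
      omega
  · have h1 := hconst m hm
    rw [← funext hF, windowSum_sub hb hbc] at h1
    rw [windowSum_sub hb hbc (fun n => 2 * F n / K)]
    have h2 : 2 * F (leftEnd a b (t - c) m) = 2 * F (leftEnd a b t m) + 2 * K := by omega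
    rw [h2, Int.add_mul_ediv_right _ _ hKpos.ne']
    ring

/-! ### Compactness -/

-- The ceiling is left-continuous and jumps on the right. As `t` enters `leftEnd` with a minus sign,
-- windows are right-continuous in `t` and need separate treatment on the left.
open Filter Topology in
theorem eventually_ceil_eq_of_lt (y : ℝ) : ∀ᶠ u in 𝓝[>] y, ⌈u⌉ = ⌊y⌋ + 1 := by
  have h : Set.Ioc y (⌊y⌋ + 1) ∈ 𝓝[>] y := Ioc_mem_nhdsGT (Int.lt_floor_add_one y)
  filter_upwards [h] with u hu
  rw [Int.ceil_eq_iff]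
  push_cast
  exact ⟨by linarith [Int.floor_le y, hu.1], hu.2⟩

open Filter Topology in
theorem eventually_ceil_eq_of_le (y : ℝ) : ∀ᶠ u in 𝓝[≤] y, ⌈u⌉ = ⌈y⌉ := by
  have h : Set.Ioc ((⌈y⌉ : ℝ) - 1) y ∈ 𝓝[≤] y :=
    Ioc_mem_nhdsLE (by linarith [Int.ceil_lt_add_one y])
  filter_upwards [h] with u hu
  rw [Int.ceil_eq_iff]
  exact ⟨hu.1, hu.2.trans (Int.le_ceil y)⟩

open Filter Topology in
theorem eventually_leftEnd_eq_of_ge {a b : ℝ} (hb : 0 < b) (t : ℝ) (m : ℤ) :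
    ∀ᶠ u in 𝓝[≥] t, leftEnd a b u m = leftEnd a b t m := by
  refine Tendsto.eventually (f := fun u : ℝ => (m * a - u) / b) ?_
    (eventually_ceil_eq_of_le ((m * a - t) / b))
  refine tendsto_nhdsWithin_of_tendsto_nhds_of_eventually_within _ ?_ ?_
  · exact (Continuous.tendsto (by fun_prop) t).mono_left nhdsWithin_le_nhds
  · filter_upwards [self_mem_nhdsWithin] with u hu
    have : t ≤ u := hu
    exact div_le_div_of_nonneg_right (by linarith) hb.le

open Filter Topology in
theorem eventually_leftEnd_eq_of_lt {a b : ℝ} (hb : 0 < b) (t : ℝ) (m : ℤ) :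
    ∀ᶠ u in 𝓝[<] t, leftEnd a b u m = ⌊(m * a - t) / b⌋ + 1 := by
  refine Tendsto.eventually (f := fun u : ℝ => (m * a - u) / b) ?_
    (eventually_ceil_eq_of_lt ((m * a - t) / b))
  refine tendsto_nhdsWithin_of_tendsto_nhds_of_eventually_within _ ?_ ?_
  · exact (Continuous.tendsto (by fun_prop) t).mono_left nhdsWithin_le_nhds
  · filter_upwards [self_mem_nhdsWithin] with u hu
    have : u < t := hu
    exact div_lt_div_of_pos_right (by linarith) hb

open Filter Topology in
theorem eventually_window_eq_of_ge {a b : ℝ} (hb : 0 < b) (c t : ℝ) (m : ℤ) :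
    ∀ᶠ u in 𝓝[≥] t, window a b c u m = window a b c t m := by
  have h : Tendsto (fun u => u - c) (𝓝[≥] t) (𝓝[≥] (t - c)) := by
    refine tendsto_nhdsWithin_of_tendsto_nhds_of_eventually_within _ ?_ ?_
    · exact (Continuous.tendsto (by fun_prop) t).mono_left nhdsWithin_le_nhds
    · filter_upwards [self_mem_nhdsWithin] with u hu
      exact sub_le_sub_right (Set.mem_Ici.1 hu) c
  filter_upwards [eventually_leftEnd_eq_of_ge (a := a) hb t m,
    h.eventually (eventually_leftEnd_eq_of_ge (a := a) hb (t - c) m)] with u h1 h2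
  rw [window, window, h1, h2]

open Filter Topology in
/-- On the left of `t` the windows are the reflected windows at `c - t`. -/
theorem eventually_window_eq_of_lt {a b : ℝ} (hb : 0 < b) (c t : ℝ) (m : ℤ) :
    ∀ᶠ u in 𝓝[<] t, ∀ n, n ∈ window a b c u m ↔ -n ∈ window a b c (c - t) (-m) := by
  have h : Tendsto (fun u => u - c) (𝓝[<] t) (𝓝[<] (t - c)) := by
    refine tendsto_nhdsWithin_of_tendsto_nhds_of_eventually_within _ ?_ ?_
    · exact (Continuous.tendsto (by fun_prop) t).mono_left nhdsWithin_le_nhds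
    · filter_upwards [self_mem_nhdsWithin] with u hu
      exact sub_lt_sub_right (Set.mem_Iio.1 hu) c
  filter_upwards [eventually_leftEnd_eq_of_lt (a := a) hb t m,
    h.eventually (eventually_leftEnd_eq_of_lt (a := a) hb (t - c) m)] with u h1 h2 n
  rw [(mem_window hb : -n ∈ window a b c (c - t) (-m) ↔ _), window, Finset.mem_Ico,
    h1, h2, Int.add_one_le_iff, Int.floor_lt,
    Int.lt_add_one_iff, Int.le_floor, div_lt_iff₀ hb, le_div_iff₀ hb, Set.mem_Ico, and_comm]
  push_cast
  refine and_congr ?_ ?_ <;> constructor <;> intro h <;> linarith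

/-- The set `D_{a,b,c}` is not empty as soon as some binary vector has all window sums two. -/
theorem gaborD_nonempty {a b c t : ℝ} (hb : 0 < b) {x : ℤ → ℤ}
    (hx : ∀ n, x n = 0 ∨ x n = 1) (h2 : ∀ m, windowSum a b c t x m = 2) :
    (gaborD a b c).Nonempty := by
  obtain ⟨k, -, hk⟩ : ∃ k ∈ window a b c t 0, x k ≠ 0 :=
    Finset.exists_ne_zero_of_sum_ne_zero (by have := h2 0; rw [windowSum] at this; omega)
  have hk1 : x k = 1 := (hx k).resolve_left hk
  refine ⟨t + k * b, fun n => (x (n + k) : ℝ), ⟨fun n => ?_, by simp [hk1]⟩, ?_⟩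
  · rcases hx (n + k) with h | h <;> simp [h]
  · rw [gaborMatrixMul_eq_windowSum hb]
    funext m
    have h := windowSum_shift a b c t hb (fun n => (x n : ℝ)) m k 0
    simp only [Int.cast_zero, zero_mul, sub_zero, add_zero] at h
    rw [h, windowSum, ← Int.cast_sum, ← windowSum, h2 m]
    norm_num

theorem exists_int_of_gaborD_nonempty {a b c : ℝ} (hb : 0 < b) (hD : (gaborD a b c).Nonempty) :
    ∃ (t : ℝ) (x : ℤ → ℤ), (∀ n, x n = 0 ∨ x n = 1) ∧ ∀ m, windowSum a b c t x m = 2 := by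
  obtain ⟨t, x, ⟨hx, -⟩, h2⟩ := hD
  rw [gaborMatrixMul_eq_windowSum hb] at h2
  obtain ⟨y, rfl⟩ : ∃ y : ℤ → ℤ, (fun n => (y n : ℝ)) = x :=
    ⟨fun n => ⌊x n⌋, funext fun n => by rcases hx n with h | h <;> simp [h]⟩
  refine ⟨t, y, fun n => ?_, fun m => ?_⟩
  · have : (y n : ℝ) = 0 ∨ (y n : ℝ) = 1 := hx n
    exact_mod_cast this
  · have := congrFun h2 m
    rw [windowSum, ← Int.cast_sum] at this
    exact_mod_cast this

open Filter Topology in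
/-- If for every `L` there are a point of `[0, a]` and a binary vector whose sums over the windows
`|m| ≤ L` are two, then `D_{a,b,c}` is not empty. -/
theorem gaborD_nonempty_of_forall {a b c : ℝ} (hb : 0 < b) {t : ℕ → ℝ}
    (ht : ∀ L, t L ∈ Set.Icc 0 a) {x : ℕ → ℤ → ℤ} (hx : ∀ L n, x L n = 0 ∨ x L n = 1)
    (h2 : ∀ L : ℕ, ∀ m ∈ Set.Icc (-L : ℤ) L, windowSum a b c (t L) (x L) m = 2) :
    (gaborD a b c).Nonempty := by
  classical
  -- A nonprincipal ultrafilter provides the limits of the points and of all coordinates at once,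
  -- and decides on which side of `s` the points lie.
  set U : Ultrafilter ℕ := hyperfilter ℕ
  have hU : (U : Filter ℕ) ≤ atTop := Nat.hyperfilter_le_atTop
  obtain ⟨s, -, hs⟩ := (isCompact_Icc (a := (0 : ℝ)) (b := a)).ultrafilter_le_nhds (U.map t)
    (le_principal_iff.2 (Filter.Eventually.of_forall ht : ∀ᶠ L in (U : Filter ℕ), _))
  have hts : Tendsto t U (𝓝 s) := hs
  set y : ℤ → ℤ := fun n => if ∀ᶠ L in (U : Filter ℕ), x L n = 1 then 1 else 0
  have hy : ∀ n, y n = 0 ∨ y n = 1 := fun n => by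
    simp only [y]
    split_ifs <;> simp
  have hyx : ∀ n, ∀ᶠ L in (U : Filter ℕ), x L n = y n := fun n => by
    by_cases h : ∀ᶠ L in (U : Filter ℕ), x L n = 1
    · simp [y, h]
    · have := Ultrafilter.eventually_not.2 h
      simp only [y, h, if_false]
      filter_upwards [this] with L hL
      exact (hx L n).resolve_right hL
  have hm : ∀ m : ℤ, ∀ᶠ L in (U : Filter ℕ), windowSum a b c (t L) (x L) m = 2 := fun m => by
    filter_upwards [hU (eventually_ge_atTop m.natAbs)] with L hL
    exact h2 L m ⟨by omega, by omega⟩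
  by_cases hge : ∀ᶠ L in (U : Filter ℕ), s ≤ t L
  · refine gaborD_nonempty (t := s) hb hy fun m => ?_
    have h1 := (tendsto_nhdsWithin_of_tendsto_nhds_of_eventually_within _ hts hge).eventually
      (eventually_window_eq_of_ge (a := a) hb c s m)
    have h3 := (eventually_all_finset (window a b c s m)).2 fun n _ => hyx n
    obtain ⟨L, e1, e2, e3⟩ := (h1.and (h3.and (hm m))).exists
    rw [← e3, windowSum, windowSum, e1]
    exact Finset.sum_congr rfl fun n hn => (e2 n hn).symm
  · have hlt : ∀ᶠ L in (U : Filter ℕ), t L < s := by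
      filter_upwards [Ultrafilter.eventually_not.2 hge] with L hL using not_le.1 hL
    -- Limits from the left produce windows for `(0, c]` instead of `[0, c)`; reflecting rows and
    -- columns turns them into genuine windows at `c - s`.
    refine gaborD_nonempty (t := c - s) hb (x := fun n => y (-n)) (fun n => hy (-n)) fun m => ?_
    have h1 := (tendsto_nhdsWithin_of_tendsto_nhds_of_eventually_within _ hts hlt).eventually
      (eventually_window_eq_of_lt (a := a) hb c s (-m))
    have h3 := (eventually_all_finset (window a b c (c - s) m)).2 fun n _ => hyx (-n)
    obtain ⟨L, e1, e2, e3⟩ := (h1.and (h3.and (hm (-m)))).exists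
    rw [← e3, windowSum, windowSum]
    refine Finset.sum_bij (fun n _ => -n) (fun n hn => ?_) (fun _ _ _ _ h => by omega)
      (fun n hn => ⟨-n, ?_, by omega⟩) (fun n hn => (e2 n hn).symm)
    · rw [e1]
      simpa using hn
    · rw [e1] at hn
      simpa using hn

/-! ### Null vectors -/

theorem gaborNullSpace_inter_eq_iff {a b c : ℝ} (ha : 0 < a) (hab : a < b) (hbc : b < c) :
    (∀ t : ℝ, gaborNullSpace a b c t ∩ (binaryVectors - binaryVectors) = {0}) ↔
      gaborD a b c = ∅ := by
  have hb := ha.trans hab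
  constructor
  · intro h
    by_contra hD
    obtain ⟨t, y, hy, hy2⟩ := exists_int_of_gaborD_nonempty hb (Set.nonempty_iff_ne_empty.2 hD)
    obtain ⟨g, hg, hgy, hg0⟩ := exists_alternating hb hbc hy hy2
    have hmem : (fun n => (g (n + 1) : ℝ) - g n) ∈
        gaborNullSpace a b c t ∩ (binaryVectors - binaryVectors) := by
      refine ⟨?_, ?_⟩
      · rw [gaborNullSpace, Set.mem_ofPred_eq, gaborMatrixMul_eq_windowSum hb]
        funext m
        have := hg0 m
        rw [windowSum] at this ⊢
        simpa using congrArg (Int.cast : ℤ → ℝ) this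
      · refine ⟨fun n => g (n + 1), fun n => ?_, fun n => g n, fun n => ?_, rfl⟩
        · rcases hg (n + 1) with h | h <;> simp [h]
        · rcases hg n with h | h <;> simp [h]
    rw [h t, Set.mem_singleton_iff] at hmem
    obtain ⟨k, -, hk⟩ : ∃ k ∈ window a b c t 0, y k ≠ 0 :=
      Finset.exists_ne_zero_of_sum_ne_zero (by have := hy2 0; rw [windowSum] at this; omega)
    have h1 : (g (k + 1) : ℝ) - g k = 0 := congrFun hmem k
    exact hk ((hgy k).1 (by exact_mod_cast h1))
  · intro hD t
    refine Set.eq_singleton_iff_unique_mem.2 ⟨⟨?_, ?_⟩, ?_⟩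
    · rw [gaborNullSpace, Set.mem_ofPred_eq, gaborMatrixMul_eq_windowSum hb]
      funext m
      simp [windowSum]
    · exact ⟨0, fun n => Or.inl rfl, 0, fun n => Or.inl rfl, sub_zero 0⟩
    · rintro z ⟨hz, -⟩
      rw [gaborNullSpace, Set.mem_ofPred_eq, gaborMatrixMul_eq_windowSum hb] at hz
      by_contra h0
      obtain ⟨k, hk⟩ := Function.ne_iff.1 h0
      -- This row puts the offset of column `k` in `[0, a)`, which is inside `[0, c)`.
      have hkw : k ∈ window a b c t ⌊(t + k * b) / a⌋ := by
        have h1 := Int.floor_le ((t + k * b) / a)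
        have h2 := Int.lt_floor_add_one ((t + k * b) / a)
        rw [le_div_iff₀ ha] at h1
        rw [div_lt_iff₀ ha] at h2
        rw [mem_window hb]
        constructor <;> linarith
      obtain ⟨x, hx, hx2⟩ := exists_binary_of_windowSum_eq_zero (t := t) (z := z) ha hab hbc
        Set.ordConnected_univ (fun m _ => congrFun hz m) (Set.mem_univ ⌊(t + k * b) / a⌋)
        hkw hk
      exact (gaborD_nonempty hb hx fun m => hx2 m (Set.mem_univ m)).ne_empty hD

/-! ### Stability -/

theorem enorm_sum_sq_le {ι E : Type*} [SeminormedAddCommGroup E] (s : Finset ι) (u : ι → E) :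
    ‖∑ i ∈ s, u i‖ₑ ^ 2 ≤ s.card * ∑ i ∈ s, ‖u i‖ₑ ^ 2 := by
  have h : ‖∑ i ∈ s, u i‖₊ ^ 2 ≤ s.card * ∑ i ∈ s, ‖u i‖₊ ^ 2 :=
    (pow_le_pow_left₀ (zero_le) (nnnorm_sum_le s u) 2).trans sq_sum_le_card_mul_sum_sq
  simp only [enorm_eq_nnnorm]
  exact_mod_cast h

/-- If the functional `z ↦ z k` vanishes on the common kernel of finitely many summation
functionals, then it is dominated by them. -/
theorem exists_enorm_sq_le_of_ker {ι : Type*} [Fintype ι] (p : ι → Finset ℤ) (k : ℤ)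
    (h : ∀ z : ℤ → ℂ, (∀ i, ∑ n ∈ p i, z n = 0) → z k = 0) :
    ∃ C : NNReal, ∀ z : ℤ → ℂ, ‖z k‖ₑ ^ 2 ≤ C * ∑ i, ‖∑ n ∈ p i, z n‖ₑ ^ 2 := by
  set Λ : ι → (ℤ → ℂ) →ₗ[ℂ] ℂ := fun i => ∑ n ∈ p i, LinearMap.proj n with hΛ
  have hval : ∀ i z, Λ i z = ∑ n ∈ p i, z n := fun i z => by simp [hΛ, LinearMap.sum_apply]
  -- A functional vanishing on the common kernel of finitely many others is a linear combination of
  -- them; its coefficients and Cauchy–Schwarz give the constant.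
  have hspan : (LinearMap.proj k : (ℤ → ℂ) →ₗ[ℂ] ℂ) ∈ Submodule.span ℂ (Set.range Λ) := by
    refine mem_span_of_iInf_ker_le_ker fun z hz => ?_
    rw [Submodule.mem_iInf] at hz
    exact h z fun i => by rw [← hval]; exact hz i
  obtain ⟨g, hg⟩ := (Submodule.mem_span_range_iff_exists_fun ℂ).1 hspan
  refine ⟨Fintype.card ι * ∑ i, ‖g i‖₊ ^ 2, fun z => ?_⟩
  have hz : z k = ∑ i, g i * ∑ n ∈ p i, z n := by
    have := LinearMap.congr_fun hg z
    simpa [LinearMap.sum_apply, hval] using this.symm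
  rw [hz]
  refine (enorm_sum_sq_le _ _).trans ?_
  rw [Finset.card_univ]
  push_cast
  rw [mul_assoc]
  refine mul_le_mul_right ?_ _
  rw [Finset.mul_sum]
  refine Finset.sum_le_sum fun i _ => ?_
  rw [enorm_mul, mul_pow]
  gcongr
  exact Finset.single_le_sum (f := fun i => (‖g i‖₊ : ℝ≥0∞) ^ 2) (fun _ _ => zero_le)
    (Finset.mem_univ i)

/-- Otherwise every `L` has a counterexample; the support-thinning argument works on an interval of
rows, and the resulting binary vectors have a limit showing that `D` is not empty. -/
theorem exists_eq_zero_of_windowSum_eq_zero {a b c : ℝ} (ha : 0 < a) (hab : a < b) (hbc : b < c)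
    (hD : gaborD a b c = ∅) :
    ∃ L : ℕ, ∀ t ∈ Set.Icc 0 a, ∀ z : ℤ → ℂ,
      (∀ m ∈ Set.Icc (-L : ℤ) L, windowSum a b c t z m = 0) → z 0 = 0 := by
  have hb := ha.trans hab
  by_contra! h
  choose t ht z hz h0 using h
  have hx : ∀ L : ℕ, ∃ x : ℤ → ℤ, (∀ n, x n = 0 ∨ x n = 1) ∧
      ∀ m ∈ Set.Icc (-L : ℤ) L, windowSum a b c (t L) x m = 2 := fun L => by
    refine exists_binary_of_windowSum_eq_zero ha hab hbc Set.ordConnected_Icc (hz L)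
      (m₀ := 0) (n₀ := 0) ⟨by omega, by omega⟩ ?_ (h0 L)
    rw [mem_window hb]
    have := ht L
    constructor
    · simpa using this.1
    · simp only [Int.cast_zero, zero_mul, sub_zero, add_zero]
      linarith [this.2]
  choose x hx1 hx2 using hx
  exact (gaborD_nonempty_of_forall hb ht hx1 hx2).ne_empty hD

/-- For `t ∈ [0, a]` the windows with `|m| ≤ L` form only finitely many patterns; the sum of the
constants of the patterns serves for all of them. -/
theorem exists_uniform_enorm_sq_le {a b c : ℝ} (ha : 0 < a) (hab : a < b) (hbc : b < c)
    (hD : gaborD a b c = ∅) :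
    ∃ (L : ℕ) (C : NNReal), ∀ t ∈ Set.Icc 0 a, ∀ z : ℤ → ℂ,
      ‖z 0‖ₑ ^ 2 ≤ C * ∑ m : Finset.Icc (-L : ℤ) L, ‖windowSum a b c t z m‖ₑ ^ 2 := by
  have hb := ha.trans hab
  obtain ⟨L, hL⟩ := exists_eq_zero_of_windowSum_eq_zero ha hab hbc hD
  set P : ℝ → Finset.Icc (-L : ℤ) L → Finset ℤ := fun t m => window a b c t m with hP
  have hfin : (P '' Set.Icc 0 a).Finite := by
    set R := Finset.Icc ⌊(-L * a - a) / b⌋ ⌈(L * a + c) / b⌉ with hR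
    refine (Set.Finite.pi' (t := fun _ : Finset.Icc (-L : ℤ) L => (R.powerset : Set (Finset ℤ)))
      fun _ => Finset.finite_toSet _).subset ?_
    rintro _ ⟨t, ht, rfl⟩ ⟨m, hm⟩
    rw [Finset.mem_coe, Finset.mem_powerset]
    intro n hn
    rw [hP, mem_window hb] at hn
    rw [Finset.mem_Icc] at hm
    have h1 : (-L : ℝ) ≤ m := by exact_mod_cast hm.1
    have h2 : (m : ℝ) ≤ L := by exact_mod_cast hm.2
    have h3 : (-L : ℝ) * a ≤ m * a := mul_le_mul_of_nonneg_right h1 ha.le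
    have h4 : (m : ℝ) * a ≤ L * a := mul_le_mul_of_nonneg_right h2 ha.le
    have h5 := hn.1
    have h6 := hn.2
    simp only at h5 h6
    rw [hR, Finset.mem_Icc]
    constructor
    · have : (-L * a - a) / b ≤ n := by
        rw [div_le_iff₀ hb]
        linarith [ht.2]
      exact_mod_cast (Int.floor_le _).trans this
    · have : (n : ℝ) ≤ (L * a + c) / b := by
        rw [le_div_iff₀ hb]
        linarith [ht.1]
      exact_mod_cast this.trans (Int.le_ceil _)
  have hex : ∀ p ∈ P '' Set.Icc 0 a, ∃ C : NNReal, ∀ z : ℤ → ℂ,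
      ‖z 0‖ₑ ^ 2 ≤ C * ∑ i, ‖∑ n ∈ p i, z n‖ₑ ^ 2 := by
    rintro _ ⟨t, ht, rfl⟩
    refine exists_enorm_sq_le_of_ker (P t) 0 fun z hz => hL t ht z fun m hm => ?_
    exact hz ⟨m, Finset.mem_Icc.2 hm⟩
  choose! C hC using hex
  refine ⟨L, ∑ p ∈ hfin.toFinset, C p, fun t ht z => ?_⟩
  have hmem : P t ∈ P '' Set.Icc 0 a := ⟨t, ht, rfl⟩
  refine (hC (P t) hmem z).trans ?_
  gcongr
  · exact Finset.single_le_sum (fun _ _ => zero_le) (hfin.mem_toFinset.2 hmem)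
  · exact le_rfl

/-- Uniform lower bound for the matrices `M_{a,b,c}(t)` on square summable vectors. -/
theorem exists_tsum_enorm_sq_le {a b c : ℝ} (ha : 0 < a) (hab : a < b) (hbc : b < c)
    (hD : gaborD a b c = ∅) :
    ∃ C : NNReal, ∀ (t : ℝ) (z : ℤ → ℂ),
      ∑' n, ‖z n‖ₑ ^ 2 ≤ C * ∑' m, ‖windowSum a b c t z m‖ₑ ^ 2 := by
  have hb := ha.trans hab
  obtain ⟨L, C, hC⟩ := exists_uniform_enorm_sq_le ha hab hbc hD
  refine ⟨C * (Finset.Icc (-L : ℤ) L).card, fun t z => ?_⟩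
  -- Shifting by column `k` and row `j k` brings the base point into `[0, a)`. Strict monotonicity
  -- comes from `a < b` and ensures that, for fixed `m`, no row `m + j k` is counted twice.
  set j : ℤ → ℤ := fun k => ⌊(t + k * b) / a⌋ with hj
  have hjmono : StrictMono j := by
    refine strictMono_int_of_lt_succ fun k => ?_
    rw [hj, ← Int.add_one_le_iff, Int.le_floor]
    push_cast
    have := Int.floor_le ((t + k * b) / a)
    rw [le_div_iff₀ ha] at this ⊢
    linarith
  have hk : ∀ k, ‖z k‖ₑ ^ 2 ≤
      C * ∑ m : Finset.Icc (-L : ℤ) L, ‖windowSum a b c t z (m + j k)‖ₑ ^ 2 := fun k => by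
    have h1 := Int.floor_le ((t + k * b) / a)
    have h2 := Int.lt_floor_add_one ((t + k * b) / a)
    rw [le_div_iff₀ ha] at h1
    rw [div_lt_iff₀ ha] at h2
    have := hC (t + k * b - j k * a) ⟨by simp only [hj]; linarith, by simp only [hj]; linarith⟩
      (fun n => z (n + k))
    simpa only [windowSum_shift a b c t hb, zero_add] using this
  refine (ENNReal.tsum_le_tsum hk).trans ?_
  rw [ENNReal.tsum_mul_left, Summable.tsum_finsetSum fun _ _ => ENNReal.summable]
  push_cast
  rw [mul_assoc]
  gcongr
  refine (Finset.sum_le_card_nsmul _ _ (∑' m, ‖windowSum a b c t z m‖ₑ ^ 2) fun m _ => ?_).trans ?_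
  · exact ENNReal.tsum_comp_le_tsum_of_injective (f := fun k => (m : ℤ) + j k)
      (fun k k' h => hjmono.injective (add_left_cancel h))
      (fun i => ‖windowSum a b c t z i‖ₑ ^ 2)
  · rw [nsmul_eq_mul, Finset.card_univ, Fintype.card_coe]

theorem card_window_le {a b c t : ℝ} (m : ℤ) :
    (window a b c t m).card ≤ ⌈c / b⌉.toNat := by
  rw [window, Int.card_Ico]
  refine Int.toNat_le_toNat ?_
  have : leftEnd a b (t - c) m ≤ leftEnd a b t m + ⌈c / b⌉ := by
    rw [leftEnd, leftEnd, show (m * a - (t - c)) / b = (m * a - t) / b + c / b by ring]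
    exact Int.ceil_add_le _ _
  omega

/-- The rows whose window contains `n`. -/
theorem mem_Ioc_of_mem_window {a b c t : ℝ} (ha : 0 < a) (hb : 0 < b) {m n : ℤ}
    (h : n ∈ window a b c t m) :
    m ∈ Finset.Ioc ⌊(t + n * b - c) / a⌋ ⌊(t + n * b) / a⌋ := by
  rw [mem_window hb] at h
  rw [Finset.mem_Ioc, Int.floor_lt, Int.le_floor, div_lt_iff₀ ha, le_div_iff₀ ha]
  constructor <;> linarith [h.1, h.2]

theorem card_Ioc_floor_le {a c : ℝ} (y : ℝ) :
    (Finset.Ioc ⌊(y - c) / a⌋ ⌊y / a⌋).card ≤ ⌈c / a⌉.toNat := by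
  rw [Int.card_Ioc]
  refine Int.toNat_le_toNat ?_
  have : ⌊y / a⌋ - ⌈c / a⌉ ≤ ⌊(y - c) / a⌋ := by
    rw [Int.le_floor, sub_div]
    push_cast
    linarith [Int.floor_le (y / a), Int.le_ceil (c / a)]
  omega

/-- Uniform upper bound for the matrices `M_{a,b,c}(t)` on square summable vectors. -/
theorem exists_tsum_windowSum_le {a b : ℝ} (c : ℝ) (ha : 0 < a) (hb : 0 < b) :
    ∃ C : NNReal, ∀ (t : ℝ) (z : ℤ → ℂ),
      ∑' m, ‖windowSum a b c t z m‖ₑ ^ 2 ≤ C * ∑' n, ‖z n‖ₑ ^ 2 := by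
  classical
  -- Bounds for the number of ones in a row and in a column.
  refine ⟨⌈c / b⌉.toNat * ⌈c / a⌉.toNat, fun t z => ?_⟩
  have h1 : ∀ m, ‖windowSum a b c t z m‖ₑ ^ 2 ≤
      ⌈c / b⌉.toNat * ∑' n, if n ∈ window a b c t m then ‖z n‖ₑ ^ 2 else 0 := fun m => by
    refine (enorm_sum_sq_le _ _).trans ?_
    gcongr
    · exact card_window_le m
    · rw [tsum_eq_sum (s := window a b c t m) fun n hn => if_neg hn]
      exact Finset.sum_le_sum fun n hn => by rw [if_pos hn]
  refine (ENNReal.tsum_le_tsum h1).trans ?_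
  rw [ENNReal.tsum_mul_left, ENNReal.tsum_comm]
  push_cast
  rw [mul_assoc]
  refine mul_le_mul_right ?_ _
  rw [← ENNReal.tsum_mul_left]
  refine ENNReal.tsum_le_tsum fun n => ?_
  set J := Finset.Ioc ⌊(t + n * b - c) / a⌋ ⌊(t + n * b) / a⌋
  rw [tsum_eq_sum (s := J) fun m hm => if_neg fun h => hm (mem_Ioc_of_mem_window ha hb h)]
  refine (Finset.sum_le_card_nsmul J _ (‖z n‖ₑ ^ 2) fun m _ => ?_).trans ?_
  · split_ifs <;> simp
  · rw [nsmul_eq_mul]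
    gcongr
    exact card_Ioc_floor_le _

/-! ### Periodization -/

open MeasureTheory in
theorem lintegral_eq_tsum_Ioc {b : ℝ} (hb : 0 < b) (s : ℝ) (f : ℝ → ℝ≥0∞) :
    ∫⁻ t, f t = ∑' k : ℤ, ∫⁻ t in Set.Ioc s (s + b), f (t + k * b) := by
  rw [← setLIntegral_univ, ← iUnion_Ioc_add_zsmul hb s,
    lintegral_iUnion (fun _ => measurableSet_Ioc) (Set.pairwise_disjoint_Ioc_add_zsmul s b)]
  refine tsum_congr fun k => ?_
  rw [← (measurePreserving_add_right volume ((k : ℝ) * b)).setLIntegral_comp_preimage_emb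
    (measurableEmbedding_addRight _) f, Set.preimage_add_const_Ioc]
  simp only [zsmul_eq_mul, Int.cast_add, Int.cast_one]
  congr 3 <;> ring_nf

open MeasureTheory in
theorem hasSum_integral_Ioc {b : ℝ} (hb : 0 < b) (s : ℝ) {f : ℝ → ℂ} (hf : Integrable f) :
    HasSum (fun k : ℤ => ∫ t in Set.Ioc s (s + b), f (t + k * b)) (∫ t, f t) := by
  have h := hasSum_integral_iUnion (f := f) (μ := volume)
    (fun _ => measurableSet_Ioc) (Set.pairwise_disjoint_Ioc_add_zsmul s b) hf.integrableOn
  rw [iUnion_Ioc_add_zsmul hb s, setIntegral_univ] at h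
  refine (congrArg (HasSum · (∫ t, f t)) (funext fun k => ?_)).mpr h
  rw [← (measurePreserving_add_right volume ((k : ℝ) * b)).setIntegral_preimage_emb
    (measurableEmbedding_addRight _) f, Set.preimage_add_const_Ioc]
  simp only [zsmul_eq_mul, Int.cast_add, Int.cast_one]
  congr 3 <;> ring_nf

/-- The columns that can meet the window of row `m` for some `t ∈ (s, s + b]`. -/
def windowHull (a b c s : ℝ) (m : ℤ) : Finset ℤ :=
  Finset.Icc ⌊(m * a - s - b) / b⌋ ⌈(m * a - s + c) / b⌉

theorem mem_windowHull {a b c s t : ℝ} (hb : 0 < b) (ht : t ∈ Set.Ioc s (s + b)) {m k : ℤ}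
    (h : t - m * a + k * b ∈ Set.Ico 0 c) : k ∈ windowHull a b c s m := by
  have h5 := h.1
  have h6 := h.2
  rw [windowHull, Finset.mem_Icc]
  constructor
  · have : (m * a - s - b) / b ≤ k := by
      rw [div_le_iff₀ hb]
      linarith [ht.2]
    exact_mod_cast (Int.floor_le _).trans this
  · have : (k : ℝ) ≤ (m * a - s + c) / b := by
      rw [le_div_iff₀ hb]
      linarith [ht.1]
    exact_mod_cast this.trans (Int.le_ceil _)

theorem windowSum_eq_sum_windowHull {a b c s t : ℝ} (hb : 0 < b) (ht : t ∈ Set.Ioc s (s + b))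
    (z : ℤ → ℂ) (m : ℤ) :
    windowSum a b c t z m =
      ∑ k ∈ windowHull a b c s m, idealWindow c (t + k * b - m * a) * z k := by
  have hcomm : ∀ k : ℤ, t + k * b - m * a = t - m * a + k * b := fun k => by ring
  rw [windowSum]
  refine Finset.sum_subset_zero_on_sdiff ?_ ?_ ?_
  · intro k hk
    exact mem_windowHull hb ht ((mem_window hb).1 hk)
  · intro k hk
    rw [Finset.mem_sdiff, mem_window hb] at hk
    rw [idealWindow, hcomm, Set.indicator_of_notMem hk.2, zero_mul]
  · intro k hk
    rw [mem_window hb] at hk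
    rw [idealWindow, hcomm, Set.indicator_of_mem hk, Pi.one_apply, one_mul]

-- The window varies with `t`; over one period it stays in the fixed finite hull, which exhibits the
-- window sum as a finite sum of `L²` functions.
open MeasureTheory in
theorem memLp_windowSum {a b c s : ℝ} (hb : 0 < b) {f : ℝ → ℂ} (hf : MemLp f 2) (m : ℤ) :
    MemLp (fun t => windowSum a b c t (fun k => f (t + k * b)) m) 2
      (volume.restrict (Set.Ioc s (s + b))) := by
  have h1 : MemLp (fun u => idealWindow c (u - m * a) * f u) 2 := by
    refine hf.of_le (AEStronglyMeasurable.mul ?_ hf.aestronglyMeasurable) ?_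
    · exact (((measurable_const (a := (1 : ℂ))).indicator measurableSet_Ico).comp
        (measurable_id.sub_const (m * a))).aestronglyMeasurable
    · refine Filter.Eventually.of_forall fun u => ?_
      by_cases hu : u - m * a ∈ Set.Ico 0 c <;> simp [idealWindow, hu]
  have h2 : MemLp (fun t => ∑ k ∈ windowHull a b c s m,
      idealWindow c (t + k * b - m * a) * f (t + k * b)) 2 :=
    memLp_finsetSum _ fun k _ =>
      h1.comp_measurePreserving (measurePreserving_add_right volume ((k : ℝ) * b))
  refine (h2.restrict _).ae_eq ?_
  filter_upwards [ae_restrict_mem measurableSet_Ioc] with t ht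
  exact (windowSum_eq_sum_windowHull hb ht _ m).symm

/-! ### Parseval's identity -/

open MeasureTheory in
/-- The analysis coefficients of the Gabor system are Fourier coefficients on `(s, s + b]`. -/
theorem inner_gaborSystem {a b c : ℝ} (hb : 0 < b) (s : ℝ)
    (f : Lp ℂ 2 (volume : Measure ℝ)) (m n : ℤ) :
    inner ℂ (gaborSystem (idealWindow c) (memLp_idealWindow c) a b (m, n)) f =
      b * fourierCoeffOn (lt_add_of_pos_right s hb)
        (fun t => windowSum a b c t (fun k => f (t + k * b)) m) (-n) := by
  set φ := gaborSystem (idealWindow c) (memLp_idealWindow c) a b (m, n) with hφ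
  set e : ℝ → ℂ := fun t => Complex.exp (2 * Real.pi * Complex.I * n * t / b) with he
  set h : ℝ → ℂ := fun t => e t * (idealWindow c (t - m * a) * f t) with hh
  have hae : (fun t => inner ℂ (φ t) (f t)) =ᵐ[volume] h := by
    filter_upwards [(memLp_gaborFun (memLp_idealWindow c) a b (m, n)).coeFn_toLp] with t ht
    rw [hφ, gaborSystem, ht, gaborFun, RCLike.inner_apply, map_mul, hh, he]
    simp only
    have h1 : (starRingEnd ℂ) (Complex.exp (-2 * Real.pi * Complex.I * n * t / b)) =
        Complex.exp (2 * Real.pi * Complex.I * n * t / b) := by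
      rw [← Complex.exp_conj]
      congr 1
      simp [map_ofNat]
    have h2 : (starRingEnd ℂ) (idealWindow c (t - m * a)) = idealWindow c (t - m * a) := by
      by_cases hu : t - m * a ∈ Set.Ico 0 c <;> simp [idealWindow, hu]
    rw [h1, h2]
    ring
  have hint : Integrable h := (L2.integrable_inner φ f).congr hae
  -- The modulation is `b`-periodic, so it factors out of the periodization.
  have hper : ∀ (t : ℝ) (k : ℤ), e (t + k * b) = e t := fun t k => by
    have hb' : (b : ℂ) ≠ 0 := by exact_mod_cast hb.ne'
    simp only [he]
    rw [Complex.exp_eq_exp_iff_exists_int]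
    refine ⟨n * k, ?_⟩
    push_cast
    field_simp
  have hintk : ∀ k : ℤ, IntegrableOn (fun t => h (t + k * b)) (Set.Ioc s (s + b)) := fun k =>
    (hint.comp_add_right ((k : ℝ) * b)).integrableOn
  have hsum : ∫ t, h t = ∑ k ∈ windowHull a b c s m, ∫ t in Set.Ioc s (s + b), h (t + k * b) := by
    refine (hasSum_integral_Ioc hb s hint).unique (hasSum_sum_of_ne_finset_zero fun k hk => ?_)
    refine setIntegral_eq_zero_of_forall_eq_zero fun t ht => ?_
    have : t + k * b - m * a ∉ Set.Ico 0 c := fun h' => hk (mem_windowHull hb ht (by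
      convert h' using 1
      ring))
    simp [hh, idealWindow, this]
  rw [L2.inner_def, integral_congr_ae hae, hsum, ← integral_finsetSum _ fun k _ => hintk k,
    fourierCoeffOn_eq_integral, intervalIntegral.integral_of_le (by linarith), add_sub_cancel_left,
    Complex.real_smul, ← mul_assoc]
  have hb' : (b : ℂ) ≠ 0 := by exact_mod_cast hb.ne'
  rw [Complex.ofReal_div, Complex.ofReal_one, mul_one_div_cancel hb', one_mul]
  refine setIntegral_congr_fun measurableSet_Ioc fun t ht => ?_
  simp only [neg_neg]
  rw [windowSum_eq_sum_windowHull hb ht, fourier_coe_apply, smul_eq_mul, Finset.mul_sum]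
  refine Finset.sum_congr rfl fun k _ => ?_
  simp only [hh]
  rw [hper]

open MeasureTheory in
theorem tsum_enorm_fourierCoeffOn_sq {s b : ℝ} (hb : 0 < b) {F : ℝ → ℂ}
    (hF : MemLp F 2 (volume.restrict (Set.Ioc s (s + b)))) :
    ∑' n, ‖(b : ℂ) * fourierCoeffOn (lt_add_of_pos_right s hb) F n‖ₑ ^ 2 =
      ENNReal.ofReal b * ∫⁻ t in Set.Ioc s (s + b), ‖F t‖ₑ ^ 2 := by
  have hP := hasSum_sq_fourierCoeffOn (lt_add_of_pos_right s hb) hF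
  have henorm : ∀ w : ℂ, ‖w‖ₑ ^ 2 = ENNReal.ofReal (‖w‖ ^ 2) := fun w => by
    rw [ENNReal.ofReal_pow (norm_nonneg w), ofReal_norm]
  have h1 : ∀ n, ‖(b : ℂ) * fourierCoeffOn (lt_add_of_pos_right s hb) F n‖ₑ ^ 2 =
      ENNReal.ofReal (b ^ 2) *
        ENNReal.ofReal (‖fourierCoeffOn (lt_add_of_pos_right s hb) F n‖ ^ 2) := fun n => by
    rw [henorm, norm_mul, mul_pow, ENNReal.ofReal_mul (by positivity), Complex.norm_real,
      Real.norm_eq_abs, sq_abs]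
  have hint : Integrable (fun t => ‖F t‖ ^ 2) (volume.restrict (Set.Ioc s (s + b))) :=
    hF.integrable_norm_pow two_ne_zero
  simp only [h1, henorm]
  rw [ENNReal.tsum_mul_left, ← ENNReal.ofReal_tsum_of_nonneg (fun _ => by positivity) hP.summable,
    hP.tsum_eq, intervalIntegral.integral_of_le (by linarith), add_sub_cancel_left,
    ← ofReal_integral_eq_lintegral_ofReal hint (Filter.Eventually.of_forall fun _ => by positivity),
    ← ENNReal.ofReal_mul (by positivity), ← ENNReal.ofReal_mul hb.le, smul_eq_mul]
  congr 1
  field_simp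

-- For each `m`, the sum over `n` is Parseval's identity on one period. The base point `s` is free,
-- so that the period can start at a chosen point.
open MeasureTheory in
theorem tsum_enorm_inner_gaborSystem_sq {a b c : ℝ} (hb : 0 < b) (s : ℝ)
    (f : Lp ℂ 2 (volume : Measure ℝ)) :
    ∑' p, ‖inner ℂ (gaborSystem (idealWindow c) (memLp_idealWindow c) a b p) f‖ₑ ^ 2 =
      ENNReal.ofReal b * ∫⁻ t in Set.Ioc s (s + b),
        ∑' m, ‖windowSum a b c t (fun k => f (t + k * b)) m‖ₑ ^ 2 := by
  have hF := fun m => memLp_windowSum (a := a) (c := c) (s := s) hb (Lp.memLp f) m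
  rw [ENNReal.tsum_prod', lintegral_tsum fun m => (hF m).aestronglyMeasurable.enorm.pow_const 2,
    ← ENNReal.tsum_mul_left]
  refine tsum_congr fun m => ?_
  rw [← tsum_enorm_fourierCoeffOn_sq hb (hF m),
    ← (Equiv.neg ℤ).tsum_eq (fun n => ‖(b : ℂ) * fourierCoeffOn _ _ n‖ₑ ^ 2)]
  refine tsum_congr fun n => ?_
  rw [inner_gaborSystem hb s, Equiv.neg_apply]

open MeasureTheory in
theorem enorm_sq_eq_lintegral_tsum {b : ℝ} (hb : 0 < b) (s : ℝ)
    (f : Lp ℂ 2 (volume : Measure ℝ)) :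
    ‖f‖ₑ ^ 2 = ∫⁻ t in Set.Ioc s (s + b), ∑' k : ℤ, ‖f (t + k * b)‖ₑ ^ 2 := by
  have hf : Measurable f := (Lp.stronglyMeasurable f).measurable
  rw [lintegral_tsum fun k => by fun_prop, ← lintegral_eq_tsum_Ioc hb s (fun t => ‖f t‖ₑ ^ 2),
    Lp.enorm_def, eLpNorm_eq_lintegral_rpow_enorm_toReal two_ne_zero ENNReal.ofNat_ne_top,
    ← ENNReal.rpow_natCast, ← ENNReal.rpow_mul]
  simp

/-- If `D_{a,b,c}` is empty, then the Gabor system is a frame. -/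
theorem isFrame_of_gaborD_eq_empty {a b c : ℝ} (ha : 0 < a) (hab : a < b) (hbc : b < c)
    (hD : gaborD a b c = ∅) :
    IsFrame (gaborSystem (idealWindow c) (memLp_idealWindow c) a b) := by
  have hb := ha.trans hab
  obtain ⟨C, hC⟩ := exists_tsum_enorm_sq_le ha hab hbc hD
  obtain ⟨B, hB⟩ := exists_tsum_windowSum_le c ha hb
  -- `C + 1` rather than `C` guarantees an invertible constant.
  refine ⟨b.toNNReal * (C + 1)⁻¹, b.toNNReal * B, by positivity, fun f => ?_⟩
  rw [tsum_enorm_inner_gaborSystem_sq hb 0, enorm_sq_eq_lintegral_tsum hb 0]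
  push_cast
  constructor
  · rw [mul_assoc, ENNReal.ofReal]
    refine mul_le_mul_right ?_ _
    rw [ENNReal.coe_inv (by positivity), ENNReal.inv_mul_le_iff (by simp) (by simp),
      ← MeasureTheory.lintegral_const_mul' _ _ (by simp)]
    refine MeasureTheory.lintegral_mono fun t => (hC t _).trans ?_
    exact mul_le_mul_left (by simp) _
  · rw [mul_assoc, ENNReal.ofReal]
    refine mul_le_mul_right ?_ _
    rw [← MeasureTheory.lintegral_const_mul' _ _ ENNReal.coe_ne_top]
    exact MeasureTheory.lintegral_mono fun t => hB t _

/-! ### Truncated null vectors -/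

/-- Truncation of an integer to `[-N, N]`. -/
def clampInt (N : ℕ) (n : ℤ) : ℤ := max (-N) (min N n)

/-- The truncation to `[-N, N)` of the vector of differences of `g`. -/
def truncDiff (g : ℤ → ℤ) (N : ℕ) (n : ℤ) : ℤ := g (clampInt N (n + 1)) - g (clampInt N n)

theorem truncDiff_of_mem {g : ℤ → ℤ} {N : ℕ} {n : ℤ} (h : n ∈ Finset.Ico (-N : ℤ) N) :
    truncDiff g N n = g (n + 1) - g n := by
  rw [Finset.mem_Ico] at h
  rw [truncDiff, clampInt, clampInt, show max (-(N : ℤ)) (min N (n + 1)) = n + 1 by omega,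
    show max (-(N : ℤ)) (min N n) = n by omega]

theorem truncDiff_of_notMem {g : ℤ → ℤ} {N : ℕ} {n : ℤ} (h : n ∉ Finset.Ico (-N : ℤ) N) :
    truncDiff g N n = 0 := by
  rw [Finset.mem_Ico] at h
  rw [truncDiff, clampInt, clampInt,
    show max (-(N : ℤ)) (min N (n + 1)) = max (-(N : ℤ)) (min N n) by omega, sub_self]

theorem windowSum_intCast (a b c t : ℝ) (z : ℤ → ℤ) (m : ℤ) :
    windowSum a b c t (fun n => (z n : ℂ)) m = windowSum a b c t z m := by
  simp [windowSum]

/-- Truncating a null vector creates only boundedly many boundary terms. -/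
theorem tsum_windowSum_truncDiff_le {a b c t : ℝ} (ha : 0 < a) (hb : 0 < b) (hbc : b < c)
    {g : ℤ → ℤ} (hg : ∀ n, g n = 0 ∨ g n = 1)
    (h0 : ∀ m, windowSum a b c t (fun n => g (n + 1) - g n) m = 0) (N : ℕ) :
    ∑' m, ‖windowSum a b c t (fun n => (truncDiff g N n : ℂ)) m‖ₑ ^ 2 ≤
      ((2 * ⌈c / a⌉.toNat : ℕ) : ℝ≥0∞) := by
  classical
  set J : ℤ → Finset ℤ := fun n => Finset.Ioc ⌊(t + n * b - c) / a⌋ ⌊(t + n * b) / a⌋ with hJ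
  have hval : ∀ m, windowSum a b c t (truncDiff g N) m =
      g (clampInt N (leftEnd a b (t - c) m)) - g (clampInt N (leftEnd a b t m)) := fun m =>
    windowSum_sub hb hbc (fun n => g (clampInt N n)) m
  -- A window avoiding both `N` and `-N` either is clamped to a single point or is untouched by
  -- clamping, where the null equation applies.
  have hzero : ∀ m, m ∉ J N ∪ J (-N) → windowSum a b c t (truncDiff g N) m = 0 := by
    intro m hm
    rw [Finset.mem_union, not_or] at hm
    have h1 : (N : ℤ) ∉ window a b c t m := fun h => hm.1 (mem_Ioc_of_mem_window ha hb h)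
    have h2 : (-N : ℤ) ∉ window a b c t m := fun h => hm.2 (mem_Ioc_of_mem_window ha hb h)
    have h3 := h0 m
    rw [windowSum_sub hb hbc] at h3
    rw [window, Finset.mem_Ico] at h1 h2
    have hlt := leftEnd_lt_leftEnd (a := a) (t := t) hb hbc m
    rw [hval, clampInt, clampInt]
    rcases le_or_gt (leftEnd a b (t - c) m) (-N) with h4 | h4
    · rw [show max (-(N : ℤ)) (min N (leftEnd a b (t - c) m)) = -N by omega,
        show max (-(N : ℤ)) (min N (leftEnd a b t m)) = -N by omega, sub_self]
    rcases le_or_gt (N : ℤ) (leftEnd a b t m) with h5 | h5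
    · rw [show max (-(N : ℤ)) (min N (leftEnd a b (t - c) m)) = N by omega,
        show max (-(N : ℤ)) (min N (leftEnd a b t m)) = N by omega, sub_self]
    rw [show max (-(N : ℤ)) (min N (leftEnd a b (t - c) m)) = leftEnd a b (t - c) m by omega,
      show max (-(N : ℤ)) (min N (leftEnd a b t m)) = leftEnd a b t m by omega, h3]
  have hone : ∀ m, ‖windowSum a b c t (fun n => (truncDiff g N n : ℂ)) m‖ₑ ^ 2 ≤ 1 := by
    intro m
    rw [windowSum_intCast, hval]
    rcases hg (clampInt N (leftEnd a b (t - c) m)) with h | h <;>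
      rcases hg (clampInt N (leftEnd a b t m)) with h' | h' <;> simp [h, h']
  rw [tsum_eq_sum (s := J N ∪ J (-N)) fun m hm => by
    rw [windowSum_intCast, hzero m hm]
    simp]
  refine (Finset.sum_le_card_nsmul _ _ 1 fun m _ => hone m).trans ?_
  rw [nsmul_eq_mul, mul_one, Nat.cast_le, two_mul]
  exact (Finset.card_union_le _ _).trans (add_le_add (card_Ioc_floor_le _) (card_Ioc_floor_le _))

-- Windows are right-continuous row by row; uniformity in `m` holds because only finitely many rows
-- meet the support of `z`.
open Filter Topology in
theorem eventually_windowSum_eq {a b : ℝ} (ha : 0 < a) (hb : 0 < b) (c t : ℝ) {z : ℤ → ℂ} {N : ℕ}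
    (hz : ∀ n, n ∉ Finset.Ico (-N : ℤ) N → z n = 0) :
    ∀ᶠ u in 𝓝[≥] t, ∀ m, windowSum a b c u z m = windowSum a b c t z m := by
  set M := Finset.Icc ⌊(t - N * b - c) / a⌋ ⌈(t + 1 + N * b) / a⌉ with hM
  have hout : ∀ u ∈ Set.Icc t (t + 1), ∀ m ∉ M, windowSum a b c u z m = 0 := by
    intro u hu m hm
    refine Finset.sum_eq_zero fun n hn => hz n fun hnN => hm ?_
    rw [mem_window hb] at hn
    rw [Finset.mem_Ico] at hnN
    have h1 : (-N : ℝ) ≤ n := by exact_mod_cast hnN.1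
    have h2 : (n : ℝ) ≤ N := by exact_mod_cast hnN.2.le
    have h3 : (-N : ℝ) * b ≤ n * b := mul_le_mul_of_nonneg_right h1 hb.le
    have h4 : (n : ℝ) * b ≤ N * b := mul_le_mul_of_nonneg_right h2 hb.le
    rw [hM, Finset.mem_Icc]
    constructor
    · have : (t - N * b - c) / a ≤ m := by
        rw [div_le_iff₀ ha]
        linarith [hu.1, hn.2]
      exact_mod_cast (Int.floor_le _).trans this
    · have : (m : ℝ) ≤ (t + 1 + N * b) / a := by
        rw [le_div_iff₀ ha]
        linarith [hu.2, hn.1]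
      exact_mod_cast this.trans (Int.le_ceil _)
  have h1 := (eventually_all_finset M).2 fun m _ => eventually_window_eq_of_ge (a := a) hb c t m
  have h2 : Set.Icc t (t + 1) ∈ 𝓝[≥] t := Icc_mem_nhdsGE (by linarith)
  filter_upwards [h1, h2] with u hu1 hu2 m
  by_cases hm : m ∈ M
  · rw [windowSum, windowSum, hu1 m hm]
  · rw [hout u hu2 m hm, hout t ⟨le_rfl, by linarith⟩ m hm]

/-! ### Functions concentrated near a lattice -/

/-- The function with value `z n` on `(t + n b, t + n b + ε]`, for `|n|` up to `N`. -/
def latticeFun (b t ε : ℝ) (N : ℕ) (z : ℤ → ℂ) (u : ℝ) : ℂ :=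
  ∑ n ∈ Finset.Ico (-N : ℤ) N, (Set.Ioc (t + n * b) (t + n * b + ε)).indicator (fun _ => z n) u

theorem memLp_latticeFun (b t ε : ℝ) (N : ℕ) (z : ℤ → ℂ) :
    MeasureTheory.MemLp (latticeFun b t ε N z) 2 MeasureTheory.volume :=
  MeasureTheory.memLp_finsetSum _ fun n _ =>
    MeasureTheory.memLp_indicator_const 2 measurableSet_Ioc (z n) (Or.inr (by simp))

theorem latticeFun_add_mul {b t ε : ℝ} (hb : 0 < b) (hε : ε ≤ b) {N : ℕ} {z : ℤ → ℂ}
    (hz : ∀ n, n ∉ Finset.Ico (-N : ℤ) N → z n = 0) {u : ℝ} (hu : u ∈ Set.Ioc t (t + b)) (k : ℤ) :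
    latticeFun b t ε N z (u + k * b) = (Set.Ioc t (t + ε)).indicator (fun _ => z k) u := by
  classical
  have hiff : ∀ n : ℤ, u + k * b ∈ Set.Ioc (t + n * b) (t + n * b + ε) ↔
      n = k ∧ u ∈ Set.Ioc t (t + ε) := by
    intro n
    constructor
    · intro h
      have h1 : ((k - n : ℤ) : ℝ) * b < 1 * b := by
        push_cast
        linarith [h.2, hu.1]
      have h2 : (-1 : ℝ) * b < ((k - n : ℤ) : ℝ) * b := by
        push_cast
        linarith [h.1, hu.2]
      have h3 : k - n < 1 := by exact_mod_cast lt_of_mul_lt_mul_right h1 hb.le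
      have h4 : -1 < k - n := by exact_mod_cast lt_of_mul_lt_mul_right h2 hb.le
      have h5 : n = k := by omega
      subst h5
      exact ⟨rfl, by linarith [h.1], by linarith [h.2]⟩
    · rintro ⟨rfl, h⟩
      exact ⟨by linarith [h.1], by linarith [h.2]⟩
  rw [latticeFun]
  by_cases hk : k ∈ Finset.Ico (-N : ℤ) N
  · rw [Finset.sum_eq_single_of_mem k hk fun n _ hn =>
      Set.indicator_of_notMem (fun h => hn ((hiff n).1 h).1) _]
    simp only [Set.indicator_apply, hiff, true_and]
  · rw [hz k hk, Finset.sum_eq_zero fun n hn => Set.indicator_of_notMem (fun h => hk ?_) _]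
    · simp
    · rw [← ((hiff n).1 h).1]
      exact hn

open MeasureTheory in
/-- The frame bound transfers to the matrices at a point. -/
theorem le_of_frame_bound {a b c : ℝ} (ha : 0 < a) (hb : 0 < b) {A : NNReal}
    (hA : ∀ f : Lp ℂ 2 (volume : Measure ℝ), (A : ℝ≥0∞) * ‖f‖ₑ ^ 2 ≤
      ∑' p, ‖inner ℂ (gaborSystem (idealWindow c) (memLp_idealWindow c) a b p) f‖ₑ ^ 2)
    (t : ℝ) {z : ℤ → ℂ} {N : ℕ} (hz : ∀ n, n ∉ Finset.Ico (-N : ℤ) N → z n = 0) :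
    (A : ℝ≥0∞) * ∑' n, ‖z n‖ₑ ^ 2 ≤
      ENNReal.ofReal b * ∑' m, ‖windowSum a b c t z m‖ₑ ^ 2 := by
  obtain ⟨v, hv, hvt⟩ := mem_nhdsGE_iff_exists_Icc_subset.1 (eventually_windowSum_eq ha hb c t hz)
  -- The first bound keeps the window sums constant on `(t, t + ε]`, the second keeps the bumps
  -- disjoint.
  set ε := min (v - t) b with hε
  have hεpos : 0 < ε := lt_min (by linarith) hb
  have hεb : ε ≤ b := min_le_right _ _
  have hεv : ∀ u ∈ Set.Ioc t (t + ε), ∀ m, windowSum a b c u z m = windowSum a b c t z m :=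
    fun u hu => hvt ⟨hu.1.le, by linarith [hu.2, min_le_left (v - t) b]⟩
  set f := (memLp_latticeFun b t ε N z).toLp with hf
  have hfe : ∀ᵐ u ∂(volume.restrict (Set.Ioc t (t + b))), ∀ k : ℤ,
      f (u + k * b) = (Set.Ioc t (t + ε)).indicator (fun _ => z k) u := by
    have h1 : ∀ᵐ u : ℝ, ∀ k : ℤ, f (u + k * b) = latticeFun b t ε N z (u + k * b) :=
      ae_all_iff.2 fun k => (measurePreserving_add_right volume
        ((k : ℝ) * b)).quasiMeasurePreserving.ae (memLp_latticeFun b t ε N z).coeFn_toLp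
    filter_upwards [ae_restrict_of_ae h1, ae_restrict_mem measurableSet_Ioc] with u hu hu' k
    rw [hu k, latticeFun_add_mul hb hεb hz hu']
  have hconst : ∀ K : ℝ≥0∞, ∫⁻ u in Set.Ioc t (t + b), (Set.Ioc t (t + ε)).indicator
      (fun _ => K) u = K * ENNReal.ofReal ε := fun K => by
    rw [lintegral_indicator measurableSet_Ioc, Measure.restrict_restrict measurableSet_Ioc,
      Set.inter_eq_left.2 (Set.Ioc_subset_Ioc_right (by linarith)), setLIntegral_const,
      Real.volume_Ioc, add_sub_cancel_left]
  have hleft : ‖f‖ₑ ^ 2 = (∑' n, ‖z n‖ₑ ^ 2) * ENNReal.ofReal ε := by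
    rw [enorm_sq_eq_lintegral_tsum hb t, ← hconst]
    refine lintegral_congr_ae ?_
    filter_upwards [hfe] with u hu
    simp only [hu]
    by_cases h : u ∈ Set.Ioc t (t + ε) <;> simp [h]
  have hright : ∫⁻ u in Set.Ioc t (t + b),
      ∑' m, ‖windowSum a b c u (fun k => f (u + k * b)) m‖ₑ ^ 2 =
        (∑' m, ‖windowSum a b c t z m‖ₑ ^ 2) * ENNReal.ofReal ε := by
    rw [← hconst]
    refine lintegral_congr_ae ?_
    filter_upwards [hfe] with u hu
    simp only [hu]
    by_cases h : u ∈ Set.Ioc t (t + ε)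
    · simp only [Set.indicator_of_mem h, hεv u h]
    · simp [Set.indicator_of_notMem h, windowSum]
  have := hA f
  rw [tsum_enorm_inner_gaborSystem_sq hb t, hleft, hright, ← mul_assoc, ← mul_assoc] at this
  exact (ENNReal.mul_le_mul_iff_left (by simpa using hεpos) ENNReal.ofReal_ne_top).1 this

/-- The support meets every window, and windows move arbitrarily far to the right. -/
theorem infinite_support_of_windowSum {a b c t : ℝ} (ha : 0 < a) (hb : 0 < b) {x : ℤ → ℤ}
    (h2 : ∀ m, windowSum a b c t x m = 2) : {n | x n ≠ 0}.Infinite := by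
  refine Set.infinite_of_not_bddAbove ?_
  rintro ⟨B, hB⟩
  set m := ⌊(t + B * b) / a⌋ + 1 with hm
  obtain ⟨n, hn, hne⟩ : ∃ n ∈ window a b c t m, x n ≠ 0 :=
    Finset.exists_ne_zero_of_sum_ne_zero (by have := h2 m; rw [windowSum] at this; omega)
  have h1 : n ≤ B := hB hne
  rw [window, Finset.mem_Ico] at hn
  have h3 : B < leftEnd a b t m := by
    rw [lt_leftEnd_iff hb, hm]
    have := Int.lt_floor_add_one ((t + B * b) / a)
    rw [div_lt_iff₀ ha] at this
    push_cast
    linarith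
  omega

/-- If the Gabor system is a frame, then `D_{a,b,c}` is empty. -/
theorem gaborD_eq_empty_of_isFrame {a b c : ℝ} (ha : 0 < a) (hab : a < b) (hbc : b < c)
    (h : IsFrame (gaborSystem (idealWindow c) (memLp_idealWindow c) a b)) :
    gaborD a b c = ∅ := by
  have hb := ha.trans hab
  obtain ⟨A, B, hApos, hAB⟩ := h
  by_contra hD
  obtain ⟨t, x, hx, h2⟩ := exists_int_of_gaborD_nonempty hb (Set.nonempty_iff_ne_empty.2 hD)
  obtain ⟨g, hg, hgx, hg0⟩ := exists_alternating hb hbc hx h2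
  set C : ℕ := 2 * ⌈c / a⌉.toNat
  -- Truncating beyond `k` chosen support points leaves norm squared at least `k`, while the image
  -- has norm squared at most `C`.
  have hbound : ∀ k : ℕ, A * k ≤ b.toNNReal * C := by
    intro k
    obtain ⟨s, hs, rfl⟩ := (infinite_support_of_windowSum ha hb h2).exists_subset_card_eq k
    set N : ℕ := s.sup Int.natAbs + 1 with hN
    have hsN : ∀ n ∈ s, n ∈ Finset.Ico (-N : ℤ) N := fun n hn => by
      have := Finset.le_sup (f := Int.natAbs) hn
      rw [Finset.mem_Ico]
      omega
    have h3 := le_of_frame_bound ha hb (fun f => (hAB f).1) t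
      (z := fun n => (truncDiff g N n : ℂ)) (N := N) fun n hn => by rw [truncDiff_of_notMem hn]; simp
    have h4 : (s.card : ℝ≥0∞) ≤ ∑' n, ‖(truncDiff g N n : ℂ)‖ₑ ^ 2 := by
      refine le_trans ?_ (ENNReal.sum_le_tsum s)
      rw [← nsmul_one s.card]
      refine Finset.card_nsmul_le_sum _ _ _ fun n hn => ?_
      rw [truncDiff_of_mem (hsN n hn)]
      have hne : g (n + 1) - g n ≠ 0 := fun h => hs hn ((hgx n).1 h)
      rcases hg (n + 1) with h | h <;> rcases hg n with h' | h' <;> simp_all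
    have h5 : (A : ℝ≥0∞) * s.card ≤ ENNReal.ofReal b * C :=
      (mul_le_mul_right h4 _).trans (h3.trans
        (mul_le_mul_right (tsum_windowSum_truncDiff_le ha hb hbc hg hg0 N) _))
    rw [ENNReal.ofReal] at h5
    exact_mod_cast h5
  obtain ⟨k, hk⟩ := exists_nat_gt (b.toNNReal * C / A)
  rw [div_lt_iff₀ hApos, mul_comm (k : NNReal)] at hk
  exact absurd (hbound k) (not_le.2 hk)
end

theorem mainTheorem5 (a b c : ℝ) (ha : 0 < a) (hab : a < b) (hbc : b < c) :
    List.TFAE [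
      IsFrame (gaborSystem (idealWindow c) (memLp_idealWindow c) a b),
      ∀ t : ℝ, gaborNullSpace a b c t ∩ (binaryVectors - binaryVectors) = {0},
      gaborD a b c = ∅] := by
  tfae_have 1 → 3 := gaborD_eq_empty_of_isFrame ha hab hbc
  tfae_have 3 → 1 := isFrame_of_gaborD_eq_empty ha hab hbc
  tfae_have 2 ↔ 3 := gaborNullSpace_inter_eq_iff ha hab hbc
  tfae_finish
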